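/- Let $N\ge 2$ be even, $a\in\mathbb Z$ coprime to $N$ and $L\ge 1$. On a $\mathbb Z_N$ qudit with basis $|s\rangle$, $s\in\mathbb Z_N$, let $X|s\rangle=|s+1\rangle$, $Z|s\rangle=e^{2\pi i s/N}|s\rangle$, $C|s\rangle=|-s\rangle$ (so $CXC^\dagger=X^\dagger$, $CZC^\dagger=Z^\dagger$). On a periodic chain of $L$ such qudits put $$\mathcal U_x=\bigotimes_{j=1}^{L}X_j^{a^{j-1}},\qquad \mathcal U_c=\bigotimes_{j=1}^{L}C_jZ_j .$$ Write $D_{2N}=\langle x,c\mid x^N=c^2=1,\ cxc^{-1}=x^{-1}\rangle$ and let $T$ be the endomorphism $T(x)=x^a$, $T(c)=c$. For $g\in D_{2N}$ let $U_{g,j}$ be the one-site operators at site $j$ with $U_{x^i,j}=X^{a^{j-1}i}$ and $U_{cx^i,j}=CZ\,X^{a^{j-1}i}$ ($0\le i<N$). For a function $\omega:D_{2N}\times D_{2N}\to U(1)$ put $\beta(\omega)=\omega(x^{N/2},c)\,\omega(c,x^{N/2})^{-1}$. Cocycles and coboundaries are $U(1)$-valued with trivial action. Then: 1. Modulo global phases,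 $x\mapsto\mathcal U_x$, $c\mapsto\mathcal U_c$ defines an isomorphism from $D_{2N}$ onto the group generated by $\mathcal U_x$ and $\mathcal U_c$; it does so without dividing by phases if and only if $N\mid\sum_{j=1}^{L}a^{j-1}$. Moreover $T$ is an automorphism and $U_{g,j+1}=U_{T(g),j}$. 2. For every site $j\geq 1$, $U_{g,j}U_{h,j}=\nu_j(g,h)U_{gh,j}$ for a 2-cocycle $\nu_j$ with $\beta(\nu_j)=(-1)^{a^{j-1}}=-1$, and $\nu_j$ is not a coboundary: each site carries a nontrivial projective class. 3. For every 2-cocycle $\omega$ on $D_{2N}$, $\beta(\omega)=(-1)^m$ for some $m\in\{0,1\}$, and $\beta(\omega)$ depends only on the class of $\omega$. For every integer $m$ with $\beta(\omega)=(-1)^m$, the pullbacks $\omega_j(g,h)=\omega(T^j(g),T^j(h))$, $j\ge 0$, satisfy $\beta(\omega_j)=(-1)^{ma^j}$, and for each $j\ge1$ the consistency condition $\beta(\omega_j)=\beta(\nu_j)\beta(\omega_{j-1})$ is equivalent to $m(a-1)\equiv1\pmod 2$. This congruence has no integer solution $m$. Consequently, for no site $j\ge 1$ do there exist 2-cocycles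 $\omega_{j-1},\omega_j$ with $\omega_j=\nu_j\,\omega_{j-1}$ and $\omega_j(g,h)=\omega_{j-1}(T(g),T(h))$ up to coboundaries. 4. There is no symmetric injective matrix product state: there are no bond dimension $D$ and matrices $A^s\in M_D(\mathbb C)$, $s\in\mathbb Z_N$, such that (i) the transfer matrix $\mathbb E=\sum_s A^s\otimes (A^s)^*$ has a nonzero eigenvalue of algebraic multiplicity one whose modulus is strictly larger than that of every other eigenvalue, and (ii) for every $k\ge1$ the vector $\psi_{kL}=\sum_{s_1,\dots,s_{kL}}\operatorname{Tr}(A^{s_1}\cdots A^{s_{kL}})|s_1\dots s_{kL}\rangle$ satisfies $\mathcal U_x^{\otimes k}\psi_{kL}=e^{i\theta_k}\psi_{kL}$ and $\mathcal U_c^{\otimes k}\psi_{kL}=e^{i\theta'_k}\psi_{kL}$ for some real $\theta_k,\theta_k'$. -/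

import Mathlib

open scoped Matrix Kronecker

noncomputable section

namespace DihedralLSM

/-! ### The clock, shift and charge-conjugation operators on a `ℤ_N` qudit

The basis states `|s⟩` of one qudit are indexed by `s : ZMod N`. -/

section Qudit

variable (N : ℕ) [NeZero N]

/-- The shift operator, `X |s⟩ = |s + 1⟩`. -/
def shift : Matrix.unitaryGroup (ZMod N) ℂ :=
  ⟨Matrix.of fun s t => if s = t + 1 then 1 else 0, by
    rw [Matrix.mem_unitaryGroup_iff]
    ext s t
    have h : ∀ x : ZMod N, (s = x + 1) ↔ x = s - 1 := fun x =>
      ⟨fun h => by rw [h]; ring, fun h => by rw [h]; ring⟩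
    rw [Matrix.mul_apply, Finset.sum_eq_single (s - 1)]
    · simp [Matrix.star_apply, Matrix.one_apply, @eq_comm _ t s]
    · intro x _ hx
      simp [h, hx]
    · simp⟩

/-- The clock operator, `Z |s⟩ = exp(2πi s / N) |s⟩`. -/
def clock : Matrix.unitaryGroup (ZMod N) ℂ :=
  ⟨Matrix.diagonal fun s => ((ZMod.toCircle s : Circle) : ℂ), by
    rw [Matrix.mem_unitaryGroup_iff, Matrix.star_eq_conjTranspose,
      Matrix.diagonal_conjTranspose, Matrix.diagonal_mul_diagonal]
    ext s t
    by_cases hst : s = t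
    · subst hst
      simp [← Circle.coe_inv_eq_conj]
    · simp [hst]⟩

/-- Charge conjugation, `C |s⟩ = |-s⟩`. -/
def chargeConj : Matrix.unitaryGroup (ZMod N) ℂ :=
  ⟨Matrix.of fun s t => if s = -t then 1 else 0, by
    rw [Matrix.mem_unitaryGroup_iff]
    ext s t
    have h : ∀ x : ZMod N, (s = -x) ↔ x = -s := fun x =>
      ⟨fun h => by rw [h]; ring, fun h => by rw [h]; ring⟩
    rw [Matrix.mul_apply, Finset.sum_eq_single (-s)]
    · simp [Matrix.star_apply, Matrix.one_apply, @eq_comm _ t s]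
    · intro x _ hx
      simp [h, hx]
    · simp⟩

/-- Charge conjugation maps `X` to `X†`. -/
theorem chargeConj_shift :
    chargeConj N * shift N * (chargeConj N)⁻¹ = (shift N)⁻¹ := by
  rw [mul_inv_eq_iff_eq_mul, eq_inv_mul_iff_mul_eq]
  ext s t
  have h1 : ∀ x : ZMod N, (s = x + 1) ↔ x = s - 1 := fun x =>
    ⟨fun h => by rw [h]; ring, fun h => by rw [h]; ring⟩
  have h2 : -1 + -t = s - 1 ↔ s = -t :=
    ⟨fun h => by rw [eq_sub_iff_add_eq] at h; rw [← h]; ring, fun h => by rw [h]; ring⟩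
  simp [shift, chargeConj, Matrix.mul_apply, h1, h2]

/-- Charge conjugation maps `Z` to `Z†`. -/
theorem chargeConj_clock :
    chargeConj N * clock N * (chargeConj N)⁻¹ = (clock N)⁻¹ := by
  rw [mul_inv_eq_iff_eq_mul, eq_inv_mul_iff_mul_eq]
  ext s t
  by_cases h : s = -t
  · subst h
    simp [clock, chargeConj, Matrix.mul_apply, Matrix.diagonal_apply, ← Circle.coe_mul,
      ← AddChar.map_add_eq_mul]
  · simp [clock, chargeConj, Matrix.mul_apply, Matrix.diagonal_apply, h]

end Qudit

/-! ### Tensor product operators on a chain -/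

/-- The tensor product `⨂ᵢ Uᵢ` of one-site unitaries, acting on the chain with `n` sites whose
product basis is indexed by the configurations `Fin n → q`. -/
def tensorUnitary {q : Type*} [Fintype q] [DecidableEq q] {n : ℕ}
    (U : Fin n → Matrix.unitaryGroup q ℂ) : Matrix.unitaryGroup (Fin n → q) ℂ :=
  ⟨Matrix.of fun s t => ∏ i, (U i : Matrix q q ℂ) (s i) (t i), by
    rw [Matrix.mem_unitaryGroup_iff]
    ext s t
    have h : ∀ i, ∑ x, (U i : Matrix q q ℂ) (s i) x * star ((U i : Matrix q q ℂ) (t i) x)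
        = if s i = t i then 1 else 0 := by
      intro i
      have := congrFun (congrFun (Matrix.mem_unitaryGroup_iff.mp (U i).2) (s i)) (t i)
      simpa [Matrix.mul_apply, Matrix.star_apply, Matrix.one_apply] using this
    have key : ∑ x : Fin n → q, ∏ i, ((U i : Matrix q q ℂ) (s i) (x i) *
        star ((U i : Matrix q q ℂ) (t i) (x i))) = ∏ i, if s i = t i then (1 : ℂ) else 0 := by
      rw [← Finset.prod_congr rfl fun i _ => h i, Finset.prod_univ_sum, Fintype.piFinset_univ]
    simp only [Matrix.mul_apply, Matrix.star_apply, Matrix.of_apply, Matrix.one_apply, star_prod,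
      ← Finset.prod_mul_distrib, key]
    by_cases hst : s = t
    · simp [hst]
    · obtain ⟨i, hi⟩ := Function.ne_iff.mp hst
      rw [if_neg hst]
      exact Finset.prod_eq_zero (Finset.mem_univ i) (if_neg hi)⟩

/-- The group of global phases `z • 1`, `|z| = 1`, inside a unitary group. -/
def phases (ι : Type*) [Fintype ι] [DecidableEq ι] : Subgroup (Matrix.unitaryGroup ι ℂ) where
  carrier := {u | ∃ z : Circle, (u : Matrix ι ι ℂ) = (z : ℂ) • 1}
  one_mem' := ⟨1, by simp⟩
  mul_mem' := by
    rintro u v ⟨z, hz⟩ ⟨w, hw⟩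
    exact ⟨z * w, by simp [hz, hw, smul_smul, mul_comm]⟩
  inv_mem' := by
    rintro u ⟨z, hz⟩
    refine ⟨z⁻¹, ?_⟩
    rw [Matrix.UnitaryGroup.inv_val, hz, star_smul, star_one, Circle.coe_inv_eq_conj]
    rfl

instance phases_normal (ι : Type*) [Fintype ι] [DecidableEq ι] : (phases ι).Normal where
  conj_mem := by
    rintro u ⟨z, hz⟩ g
    refine ⟨z, ?_⟩
    have h : (g : Matrix ι ι ℂ) * star (g : Matrix ι ι ℂ) = 1 :=
      Matrix.mem_unitaryGroup_iff.mp g.2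
    simp [Matrix.UnitaryGroup.inv_val, hz, h]

/-! ### The dihedral symmetry with exponentially modulated rotations

Sites are counted from `0`, so the site `j` of the code is the `(j + 1)`-st site of the chain. -/

section Symmetry

variable (N : ℕ) [NeZero N] (a : ℤ)

/-- The operator `∏ X_i ^ (a ^ i)` on `n` sites, where the exponents `1, a, …, a ^ (L - 1)` of the
unit cell with `L` sites are repeated periodically. -/
def symX (L n : ℕ) : Matrix.unitaryGroup (Fin n → ZMod N) ℂ :=
  tensorUnitary fun i => shift N ^ (a ^ ((i : ℕ) % L))

/-- The operator `∏ C_i Z_i` on `n` sites. -/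
def symC (n : ℕ) : Matrix.unitaryGroup (Fin n → ZMod N) ℂ :=
  tensorUnitary fun _ => chargeConj N * clock N

/-- The action of the dihedral group of order `2 N` on the site `j`: the rotation generator
`x = r 1` acts by `X ^ (a ^ j)`, the reflection `c = sr 0` acts by `C Z`, and
`c x ^ i = sr i` acts by the product of the two operators. -/
def siteOp (j : ℕ) : DihedralGroup N → Matrix.unitaryGroup (ZMod N) ℂ
  | .r i => shift N ^ (a ^ j * (i.val : ℤ))
  | .sr i => (chargeConj N * clock N) * shift N ^ (a ^ j * (i.val : ℤ))

/-- The endomorphism `x ↦ x ^ a`, `c ↦ c` of the dihedral group. -/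
def translation : DihedralGroup N →* DihedralGroup N where
  toFun
    | .r i => .r (a * i)
    | .sr i => .sr (a * i)
  map_one' := by
    change DihedralGroup.r ((a : ZMod N) * 0) = DihedralGroup.r 0
    rw [mul_zero]
  map_mul' := by
    rintro (i | i) (j | j) <;> simp [mul_add, mul_sub]

end Symmetry

/-! ### Projective representations and `U(1)`-valued 2-cocycles -/

section Cocycle

variable {G : Type*} [Group G]

/-- `ν` is the factor system of the family `U`: `U_g U_h = ν(g,h) U_{gh}`. -/
def IsFactorSystem {q : Type*} [Fintype q] [DecidableEq q]
    (U : G → Matrix.unitaryGroup q ℂ) (ν : G × G → Circle) : Prop :=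
  ∀ g h, (U g : Matrix q q ℂ) * (U h : Matrix q q ℂ) = (ν (g, h) : ℂ) • (U (g * h) : Matrix q q ℂ)

/-- 2-cocycles with values in `U(1)`, on which `G` acts trivially. -/
def IsCocycle (ω : G × G → Circle) : Prop :=
  letI : SMul G Circle := ⟨fun _ z => z⟩
  groupCohomology.IsMulCocycle₂ ω

/-- 2-coboundaries with values in `U(1)`, on which `G` acts trivially. -/
def IsCoboundary (ω : G × G → Circle) : Prop :=
  letI : SMul G Circle := ⟨fun _ z => z⟩
  groupCohomology.IsMulCoboundary₂ ω

/-- Equality up to coboundaries. -/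
def Cohomologous (ω ω' : G × G → Circle) : Prop := IsCoboundary (ω / ω')

/-- The pullback `(g, h) ↦ ω(T g, T h)` of a 2-cochain. -/
def pullback (T : G → G) (ω : G × G → Circle) : G × G → Circle :=
  fun p => ω (T p.1, T p.2)

/-- The phase `ω(x^{N/2}, c) ω(c, x^{N/2})⁻¹` of a 2-cochain on the dihedral group. -/
def halfTurnPhase {N : ℕ} (ω : DihedralGroup N × DihedralGroup N → Circle) : ℂ :=
  let x : DihedralGroup N := .r ((N / 2 : ℕ) : ZMod N)
  let c : DihedralGroup N := .sr 0
  ((ω (x, c) / ω (c, x) : Circle) : ℂ)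

end Cocycle

/-! ### Matrix product states -/

section MPS

variable {q : Type*} [Fintype q] {D : ℕ}

/-- The translation invariant periodic matrix product state on `n` sites:
`ψ(s₁, …, sₙ) = Tr (A^{s₁} ⋯ A^{sₙ})`. -/
def mpsState (A : q → Matrix (Fin D) (Fin D) ℂ) (n : ℕ) : (Fin n → q) → ℂ :=
  fun s => (List.ofFn fun i => A (s i)).prod.trace

/-- The transfer matrix `𝔼 = ∑ₛ A^s ⊗ (A^s)^*`. -/
def transferMatrix (A : q → Matrix (Fin D) (Fin D) ℂ) :
    Matrix (Fin D × Fin D) (Fin D × Fin D) ℂ :=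
  ∑ s, A s ⊗ₖ (A s).map star

/-- Injectivity: the transfer matrix has a nonzero, nondegenerate (algebraically simple) dominant
eigenvalue, which is separated from all other eigenvalues by a gap in modulus. -/
def IsInjectiveMPS (A : q → Matrix (Fin D) (Fin D) ℂ) : Prop :=
  ∃ lam : ℂ, lam ≠ 0 ∧ (transferMatrix A).charpoly.rootMultiplicity lam = 1 ∧
    ∀ μ : ℂ, (transferMatrix A).charpoly.IsRoot μ → μ ≠ lam → ‖μ‖ < ‖lam‖

/-- `U ψ = e^{iθ} ψ` for some phase `e^{iθ}`. -/
def IsInvariantUpToPhase {ι : Type*} [Fintype ι] [DecidableEq ι]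
    (U : Matrix.unitaryGroup ι ℂ) (ψ : ι → ℂ) : Prop :=
  ∃ z : Circle, (U : Matrix ι ι ℂ) *ᵥ ψ = (z : ℂ) • ψ

/-- The matrix product state of `A` is symmetric under the two generators with unit cell of `L`
sites: for every `k ≥ 1`, the state on `k L` sites is invariant up to a phase under the `k`-fold
periodic extension of each of them. -/
def IsSymmetricMPS (N : ℕ) [NeZero N] (a : ℤ) (L : ℕ)
    (A : ZMod N → Matrix (Fin D) (Fin D) ℂ) : Prop :=
  ∀ k : ℕ, 0 < k →
    IsInvariantUpToPhase (symX N a L (k * L)) (mpsState A (k * L)) ∧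
    IsInvariantUpToPhase (symC N (k * L)) (mpsState A (k * L))

end MPS

end DihedralLSM

end

/-! ### Traces of powers and the eigenvalues of a matrix -/

section TracePow

open Module Module.End

variable {K V : Type*} [Field K] [AddCommGroup V] [Module K V] [FiniteDimensional K V]

/-! Since `N` is even and `a` is coprime to it, `a` is odd, so `a * (N/2) = N/2` in `ZMod N`. Hence
the half turn `x^{N/2}` is untouched by the modulation: it acts as `X^{N/2}` on every site and is
fixed by `translation`. It commutes with `c` in the dihedral group, while `X^{N/2}` anticommutes
with `C Z`.

Because the half turn and `c` commute, `halfTurnPhase` is the commutator of their lifts. It is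
therefore a class invariant (`halfTurnPhase_congr`), and a sign because the half turn squares to
`1`. It equals `-1` on each site (`halfTurnPhase_siteOp`) and is preserved by pullback along
`translation` (`halfTurnPhase_pullback`). A compatible pair of bond classes would thus have an
invariant equal to its own negative. The statements on the generated group come from the explicit
factor system: a unit cell contributes only phases whose exponents are multiples of the sum of the
`a ^ j`.

The statement on matrix product states is proved analytically, without constructing a representation
on the virtual space. The `N/2`-th power of the modulated symmetry is the uniform product of `P =
X^{N/2}`, and the other symmetry is the uniform product of `Q = C Z`. Expectation values of uniform
products are traces of powers of a twisted transfer matrix (`trace_twistedTransferMatrix_pow`), that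
is, power sums of its eigenvalues. Injectivity gives the squared norm of the state the growth rate
`r ^ n`, and symmetry forces the twisted traces to have the same modulus at lengths `k * L`. A power
sum whose modulus tends to `1` along multiples of `L` does so along all lengths
(`tendsto_norm_powerSum`). At a large odd length, where the products of `P` and of `Q` anticommute,
the normalised state is then nearly an eigenvector of both, contradicting
`norm_inner_sq_le_of_anticommute`. -/

theorem LinearMap.trace_pow_of_isNilpotent_sub_algebraMap (f : End K V) (μ : K)
    (h : IsNilpotent (f - algebraMap K (End K V) μ)) (n : ℕ) :
    LinearMap.trace K V (f ^ n) = finrank K V * μ ^ n := by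
  induction n with
  | zero => simp
  | succ n ih =>
    have := LinearMap.trace_comp_eq_mul_of_commute_of_isNilpotent μ
      (Commute.pow_left (Commute.refl f) n) h
    rw [pow_succ, Module.End.mul_eq_comp, this, ih]
    ring

/-- The space is the direct sum of the generalised eigenspaces, on each of which `f` is a scalar
plus a nilpotent; their dimensions are the root multiplicities. -/
theorem LinearMap.trace_pow_eq_sum_roots [IsAlgClosed K] [DecidableEq K] (f : End K V) (n : ℕ) :
    LinearMap.trace K V (f ^ n) =
      ∑ μ ∈ f.charpoly.roots.toFinset, (f.charpoly.rootMultiplicity μ : K) * μ ^ n := by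
  have hds := DirectSum.isInternal_submodule_of_iSupIndep_of_iSup_eq_top
      f.independent_maxGenEigenspace f.iSup_maxGenEigenspace_eq_top
  have hfin : {μ | f.maxGenEigenspace μ ≠ ⊥}.Finite :=
      WellFoundedGT.finite_ne_bot_of_iSupIndep f.independent_maxGenEigenspace
  have hmaps (μ : K) : Set.MapsTo f (f.maxGenEigenspace μ) (f.maxGenEigenspace μ) :=
    f.mapsTo_maxGenEigenspace_of_comm (Commute.refl _) μ
  have hmapsn (μ : K) : Set.MapsTo (f ^ n) (f.maxGenEigenspace μ) (f.maxGenEigenspace μ) :=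
    f.mapsTo_maxGenEigenspace_of_comm (Commute.pow_right (Commute.refl f) n) μ
  rw [LinearMap.trace_eq_sum_trace_restrict' hds hfin hmapsn]
  have hs : hfin.toFinset = f.charpoly.roots.toFinset := by
    ext μ
    rw [Set.Finite.mem_toFinset, Set.mem_ofPred_eq, Multiset.mem_toFinset,
      ← Multiset.count_pos, Polynomial.count_roots, ← LinearMap.finrank_maxGenEigenspace_eq,
      Module.finrank_pos_iff, Submodule.nontrivial_iff_ne_bot]
  rw [hs]
  refine Finset.sum_congr rfl fun μ _ => ?_
  rw [← LinearMap.finrank_maxGenEigenspace_eq, ← LinearMap.trace_pow_of_isNilpotent_sub_algebraMap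
    (f.restrict (hmaps μ)) μ (f.isNilpotent_restrict_maxGenEigenspace_sub_algebraMap μ)]
  exact congrArg _ (Module.End.pow_restrict n (hmaps μ) (hmapsn μ)).symm

theorem Matrix.trace_pow_eq_sum_roots {ι : Type*} [Fintype ι] [DecidableEq ι] [IsAlgClosed K]
    [DecidableEq K] (M : Matrix ι ι K) (n : ℕ) :
    (M ^ n).trace =
      ∑ μ ∈ M.charpoly.roots.toFinset, (M.charpoly.rootMultiplicity μ : K) * μ ^ n := by
  have := LinearMap.trace_pow_eq_sum_roots (Matrix.toLin' M) n
  rw [Matrix.charpoly_toLin', ← Matrix.toLin'_pow, Matrix.trace_toLin'_eq] at this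
  exact this

end TracePow

/-! ### Power sums of complex numbers -/

section PowerSums

open Filter Topology

/-- Simultaneous recurrence: some arbitrarily large powers of finitely many phases are close
to `1`. -/
theorem frequently_forall_pow_near_one {ι : Type*} [Finite ι] (u : ι → Circle) {ε : ℝ}
    (hε : 0 < ε) : ∃ᶠ n : ℕ in atTop, ∀ i, ‖((u i ^ n : Circle) : ℂ) - 1‖ < ε := by
  have h := mapClusterPt_one_atTop_pow u
  have hU : {v : ι → Circle | ∀ i, ‖((v i : Circle) : ℂ) - 1‖ < ε} ∈ 𝓝 (1 : ι → Circle) := by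
    refine IsOpen.mem_nhds ?_ fun _ => by simpa using hε
    rw [Set.ofPred_forall]
    refine isOpen_iInter_of_finite fun i => isOpen_lt ?_ continuous_const
    fun_prop
  exact h.frequently hU

/-- Recurrence applied to the phases in polar form. At such exponents the terms of a power sum with
positive weights cannot cancel much. -/
theorem exists_norm_le_re_pow {ι : Type*} [Finite ι] (z : ι → ℂ) {ε : ℝ} (hε : 0 < ε) :
    ∃ᶠ n : ℕ in atTop, ∀ i, (1 - ε) * ‖z i‖ ^ n ≤ (z i ^ n).re := by
  have hz (i : ι) : ∃ u : Circle, z i = ‖z i‖ * u := by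
    refine ⟨Circle.exp (z i).arg, ?_⟩
    rw [Circle.coe_exp, Complex.norm_mul_exp_arg_mul_I]
  choose u hu using hz
  refine (frequently_forall_pow_near_one u hε).mono fun n hn i => ?_
  have h1 : (z i ^ n).re = ‖z i‖ ^ n * ((u i ^ n : Circle) : ℂ).re := by
    conv_lhs => rw [hu i, mul_pow, ← Complex.ofReal_pow, Complex.re_ofReal_mul]
    simp
  have h2 : 1 - ε ≤ ((u i ^ n : Circle) : ℂ).re := by
    have h3 := (Complex.abs_re_le_norm _).trans (hn i).le
    rw [Complex.sub_re, Complex.one_re, abs_le] at h3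
    linarith [h3.1]
  rw [h1, mul_comm]
  gcongr

/-- If the modulus of a power sum tends to `1` along the multiples of some `L`, then it tends to
`1`: there is exactly one term that does not decay. -/
theorem tendsto_norm_powerSum {ι : Type*} [Fintype ι] (m : ι → ℕ) (hm : ∀ i, 0 < m i)
    (z : ι → ℂ) {L : ℕ} (hL : 0 < L)
    (h : Tendsto (fun k : ℕ => ‖∑ i, (m i : ℂ) * z i ^ (k * L)‖) atTop (𝓝 1)) :
    Tendsto (fun n : ℕ => ‖∑ i, (m i : ℂ) * z i ^ n‖) atTop (𝓝 1) := by
  classical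
  have hkL : Tendsto (fun k : ℕ => k * L) atTop atTop := tendsto_id.atTop_mul_const' hL
  -- At recurrent exponents the sum of moduli exceeds the modulus of the sum by a factor of at most
  -- `10/9`, and `(11/10) * (10/9) < 5/4`. What matters below is that `5/4 < 2`.
  have hfreq : ∃ᶠ k : ℕ in atTop, ∑ i, (m i : ℝ) * ‖z i‖ ^ (k * L) ≤ 5 / 4 := by
    have h1 : ∀ᶠ k : ℕ in atTop, ‖∑ i, (m i : ℂ) * z i ^ (k * L)‖ ≤ 11 / 10 :=
      (h.eventually (ge_mem_nhds (by norm_num)))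
    refine ((exists_norm_le_re_pow (fun i => z i ^ L)
      (show (0 : ℝ) < 1 / 10 by norm_num)).and_eventually h1).mono ?_
    rintro k ⟨h2, h3⟩
    have h4 : ∑ i, (m i : ℝ) * ((1 - 1 / 10) * ‖z i‖ ^ (k * L)) ≤
        (∑ i, (m i : ℂ) * z i ^ (k * L)).re := by
      rw [Complex.re_sum]
      refine Finset.sum_le_sum fun i _ => ?_
      rw [← Complex.ofReal_natCast, Complex.re_ofReal_mul]
      have := h2 i
      rw [norm_pow, ← pow_mul, ← pow_mul, mul_comm L k] at this
      gcongr
    have h5 := (h4.trans (Complex.re_le_norm _)).trans h3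
    have h6 : ∑ i, (m i : ℝ) * ((1 - 1 / 10) * ‖z i‖ ^ (k * L)) =
        9 / 10 * ∑ i, (m i : ℝ) * ‖z i‖ ^ (k * L) := by
      rw [Finset.mul_sum]
      exact Finset.sum_congr rfl fun i _ => by ring
    linarith
  have hle (i : ι) : ‖z i‖ ≤ 1 := by
    by_contra! hi
    have h1 := ((tendsto_pow_atTop_atTop_of_one_lt hi).comp hkL).eventually_gt_atTop (5 / 4)
    obtain ⟨k, hk, hk'⟩ := (hfreq.and_eventually h1).exists
    have h2 : (m i : ℝ) * ‖z i‖ ^ (k * L) ≤ ∑ i, (m i : ℝ) * ‖z i‖ ^ (k * L) :=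
      Finset.single_le_sum (f := fun i => (m i : ℝ) * ‖z i‖ ^ (k * L))
        (fun i _ => by positivity) (Finset.mem_univ i)
    have h3 : (1 : ℝ) ≤ m i := by exact_mod_cast hm i
    simp only [Function.comp] at hk'
    nlinarith
  have hdecay (i : ι) (hi : ‖z i‖ ≠ 1) :
      Tendsto (fun n : ℕ => (m i : ℂ) * z i ^ n) atTop (𝓝 0) := by
    simpa using (tendsto_pow_atTop_nhds_zero_of_norm_lt_one
      (lt_of_le_of_ne (hle i) hi)).const_mul (m i : ℂ)
  -- A term of modulus `1` must have weight `1` and be the only one, since otherwise the sum of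
  -- moduli would be at least `2`. If there were none, the sum would tend to `0`.
  by_cases hex : ∃ i, ‖z i‖ = 1
  · obtain ⟨i, hi⟩ := hex
    obtain ⟨k, hk⟩ := hfreq.exists
    have hsum : m i + ∑ j ∈ Finset.univ.erase i, (m j : ℝ) * ‖z j‖ ^ (k * L) ≤ 5 / 4 := by
      rw [← Finset.add_sum_erase _ _ (Finset.mem_univ i), hi] at hk
      simpa using hk
    have hmi : m i = 1 := by
      have h0 : 0 ≤ ∑ j ∈ Finset.univ.erase i, (m j : ℝ) * ‖z j‖ ^ (k * L) :=
        Finset.sum_nonneg fun j _ => by positivity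
      have h1 : (m i : ℝ) < 2 := by linarith
      have h2 : m i < 2 := by exact_mod_cast h1
      have := hm i
      omega
    have hlt (j : ι) (hj : j ∈ Finset.univ.erase i) : ‖z j‖ ≠ 1 := by
      intro hj1
      have h0 := Finset.single_le_sum (f := fun j => (m j : ℝ) * ‖z j‖ ^ (k * L))
        (fun j _ => by positivity) hj
      have h3 : (1 : ℝ) ≤ m j := by exact_mod_cast hm j
      have h4 : (1 : ℝ) ≤ m i := by exact_mod_cast hm i
      simp only [hj1, one_pow, mul_one] at h0
      linarith
    have hrest : Tendsto (fun n : ℕ => ‖∑ j ∈ Finset.univ.erase i, (m j : ℂ) * z j ^ n‖)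
        atTop (𝓝 0) := by
      simpa using (tendsto_finsetSum _ fun j hj => hdecay j (hlt j hj)).norm
    rw [tendsto_iff_norm_sub_tendsto_zero]
    refine squeeze_zero (fun _ => norm_nonneg _) (fun n => ?_) hrest
    have h5 : ∑ j, (m j : ℂ) * z j ^ n =
        z i ^ n + ∑ j ∈ Finset.univ.erase i, (m j : ℂ) * z j ^ n := by
      rw [← Finset.add_sum_erase _ _ (Finset.mem_univ i), hmi]
      simp
    have h6 : ‖z i ^ n‖ = 1 := by rw [norm_pow, hi, one_pow]
    rw [h5, ← h6]
    simpa using abs_norm_sub_norm_le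
      (z i ^ n + ∑ j ∈ Finset.univ.erase i, (m j : ℂ) * z j ^ n) (z i ^ n)
  · push Not at hex
    have h0 : Tendsto (fun n : ℕ => ‖∑ j, (m j : ℂ) * z j ^ n‖) atTop (𝓝 0) := by
      simpa using (tendsto_finsetSum Finset.univ fun j _ => hdecay j (hex j)).norm
    exact absurd (tendsto_nhds_unique h (h0.comp hkL)) one_ne_zero

end PowerSums

namespace DihedralLSM

/-! ### Tensor products of operators -/

section Tensor

variable {q : Type*} [Fintype q] [DecidableEq q] {n : ℕ}

theorem tensorUnitary_apply (U : Fin n → Matrix.unitaryGroup q ℂ) (s t : Fin n → q) :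
    (tensorUnitary U : Matrix (Fin n → q) (Fin n → q) ℂ) s t =
      ∏ i, (U i : Matrix q q ℂ) (s i) (t i) := rfl

theorem tensorUnitary_mul (U V : Fin n → Matrix.unitaryGroup q ℂ) :
    tensorUnitary U * tensorUnitary V = tensorUnitary fun i => U i * V i := by
  ext s t
  simp only [Matrix.UnitaryGroup.mul_val, tensorUnitary_apply, Matrix.mul_apply,
    ← Finset.prod_mul_distrib]
  rw [Finset.prod_univ_sum, Fintype.piFinset_univ]

theorem tensorUnitary_one : tensorUnitary (fun _ : Fin n => (1 : Matrix.unitaryGroup q ℂ)) = 1 := by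
  have h := tensorUnitary_mul (fun _ : Fin n => (1 : Matrix.unitaryGroup q ℂ)) fun _ => 1
  simpa using h

variable (q n) in
/-- The tensor product of one-site unitaries as a group homomorphism. -/
def tensorUnitaryHom : (Fin n → Matrix.unitaryGroup q ℂ) →* Matrix.unitaryGroup (Fin n → q) ℂ where
  toFun := tensorUnitary
  map_one' := tensorUnitary_one
  map_mul' U V := (tensorUnitary_mul U V).symm

theorem tensorUnitary_pow (U : Fin n → Matrix.unitaryGroup q ℂ) (k : ℕ) :
    tensorUnitary U ^ k = tensorUnitary fun i => U i ^ k :=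
  (map_pow (tensorUnitaryHom q n) U k).symm

theorem tensorUnitary_smul {U V : Fin n → Matrix.unitaryGroup q ℂ} {z : Fin n → ℂ}
    (h : ∀ i, (U i : Matrix q q ℂ) = z i • (V i : Matrix q q ℂ)) :
    (tensorUnitary U : Matrix (Fin n → q) (Fin n → q) ℂ) =
      (∏ i, z i) • (tensorUnitary V : Matrix (Fin n → q) (Fin n → q) ℂ) := by
  ext s t
  simp [tensorUnitary_apply, h, Finset.prod_mul_distrib]

end Tensor

/-! ### Invariance up to phases -/

section Invariance

variable {ι : Type*} [Fintype ι] [DecidableEq ι]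

theorem IsInvariantUpToPhase.pow {U : Matrix.unitaryGroup ι ℂ} {ψ : ι → ℂ}
    (h : IsInvariantUpToPhase U ψ) (k : ℕ) : IsInvariantUpToPhase (U ^ k) ψ := by
  obtain ⟨z, hz⟩ := h
  refine ⟨z ^ k, ?_⟩
  induction k with
  | zero => simp
  | succ k ih =>
    rw [pow_succ', Matrix.UnitaryGroup.mul_val, ← Matrix.mulVec_mulVec, ih, Matrix.mulVec_smul, hz,
      smul_smul]
    simp [pow_succ]

/-- Two anticommuting isometries have no common approximate eigenvector. -/
theorem norm_inner_sq_le_of_anticommute {E : Type*} [NormedAddCommGroup E] [InnerProductSpace ℂ E]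
    (P Q : E →ₗ[ℂ] E) (hP : ∀ v, ‖P v‖ = ‖v‖) (hQ : ∀ v, ‖Q v‖ = ‖v‖)
    (hPQ : ∀ v, P (Q v) = -Q (P v)) {ψ : E} (hψ : ‖ψ‖ = 1)
    (hPψ : 3 / 4 < ‖inner ℂ ψ (P ψ)‖ ^ 2) : ‖inner ℂ ψ (Q ψ)‖ ^ 2 ≤ 3 / 4 := by
  by_contra! hQψ
  have key (T : E →ₗ[ℂ] E) (hT : ∀ v, ‖T v‖ = ‖v‖) (h : 3 / 4 < ‖inner ℂ ψ (T ψ)‖ ^ 2) :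
      ‖T ψ - inner ℂ ψ (T ψ) • ψ‖ < 1 / 2 ∧ ‖inner ℂ ψ (T ψ)‖ ≤ 1 := by
    have h1 : ‖T ψ - inner ℂ ψ (T ψ) • ψ‖ ^ 2 = 1 - ‖inner ℂ ψ (T ψ)‖ ^ 2 := by
      rw [@norm_sub_sq ℂ, inner_smul_right, hT, norm_smul, hψ, ← inner_conj_symm (T ψ) ψ,
        Complex.mul_conj, Complex.normSq_eq_norm_sq]
      simp only [RCLike.re_to_complex, Complex.ofReal_re]
      ring
    refine ⟨?_, ?_⟩
    · nlinarith [norm_nonneg (T ψ - inner ℂ ψ (T ψ) • ψ)]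
    · simpa [hT, hψ] using norm_inner_le_norm (𝕜 := ℂ) ψ (T ψ)
  obtain ⟨hp, hp'⟩ := key P hP hPψ
  obtain ⟨hq, hq'⟩ := key Q hQ hQψ
  set p := inner ℂ ψ (P ψ)
  set r := inner ℂ ψ (Q ψ)
  -- By anticommutation `2 P Q ψ` is the commutator applied to `ψ`, in which the scalar parts `p r
  -- ψ` cancel. Four terms of norm below `1/2` remain, against a left side of norm `2`.
  have h2 : (2 : ℂ) • P (Q ψ) = (P (Q ψ - r • ψ) + r • (P ψ - p • ψ)) -
      (Q (P ψ - p • ψ) + p • (Q ψ - r • ψ)) := by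
    simp only [map_sub, map_smul, smul_sub, two_smul]
    rw [smul_comm r p]
    conv_lhs => rw [← neg_neg (P (Q ψ))]
    have := hPQ ψ
    rw [this]
    abel
  have h3 : ‖(2 : ℂ) • P (Q ψ)‖ = 2 := by
    rw [norm_smul, hP, hQ, hψ]
    simp
  have h4 : ‖(2 : ℂ) • P (Q ψ)‖ ≤ (‖Q ψ - r • ψ‖ + ‖r‖ * ‖P ψ - p • ψ‖) +
      (‖P ψ - p • ψ‖ + ‖p‖ * ‖Q ψ - r • ψ‖) := by
    rw [h2]
    refine (norm_sub_le _ _).trans (add_le_add ((norm_add_le _ _).trans ?_)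
      ((norm_add_le _ _).trans ?_)) <;> rw [norm_smul]
    · rw [hP]
    · rw [hQ]
  nlinarith [norm_nonneg (Q ψ - r • ψ), norm_nonneg (P ψ - p • ψ)]

end Invariance

/-! ### Transfer matrices twisted by an on-site operator -/

section Transfer

theorem sum_pow_eq_sum_list_prod {X R : Type*} [Fintype X] [Semiring R] (B : X → R) (n : ℕ) :
    (∑ x, B x) ^ n = ∑ w : Fin n → X, (List.ofFn fun i => B (w i)).prod := by
  induction n with
  | zero => simp
  | succ n ih =>
    rw [pow_succ', ih, ← (Fin.consEquiv fun _ => X).sum_comp, Fintype.sum_prod_type,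
      Finset.sum_mul_sum]
    simp [Fin.consEquiv]

variable {q : Type*} [Fintype q] {D : ℕ}

theorem list_prod_smul_kronecker {n : ℕ} (c : Fin n → ℂ) (B C : Fin n → Matrix (Fin D) (Fin D) ℂ) :
    (List.ofFn fun i => c i • (B i ⊗ₖ C i)).prod =
      (∏ i, c i) • ((List.ofFn B).prod ⊗ₖ (List.ofFn C).prod) := by
  induction n with
  | zero => simp
  | succ n ih =>
    rw [List.ofFn_succ, List.prod_cons, ih, List.ofFn_succ, List.ofFn_succ, List.prod_cons,
      List.prod_cons, Fin.prod_univ_succ, smul_mul_smul_comm, Matrix.mul_kronecker_mul]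

/-- The transfer matrix with an operator `U` inserted between the two layers. -/
def twistedTransferMatrix (U : Matrix q q ℂ) (A : q → Matrix (Fin D) (Fin D) ℂ) :
    Matrix (Fin D × Fin D) (Fin D × Fin D) ℂ :=
  ∑ p : q × q, U p.1 p.2 • (A p.2 ⊗ₖ (A p.1).map star)

theorem trace_list_prod_map_star {n : ℕ} (B : Fin n → Matrix (Fin D) (Fin D) ℂ) :
    (List.ofFn fun i => (B i).map star).prod.trace = star (List.ofFn B).prod.trace := by
  have h : (List.ofFn fun i => (B i).map star).prod =
      (starRingEnd ℂ).mapMatrix (List.ofFn B).prod := by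
    rw [map_list_prod, List.map_ofFn]
    rfl
  rw [h]
  exact (AddMonoidHom.map_trace (starRingEnd ℂ) _).symm

variable [DecidableEq q]

theorem twistedTransferMatrix_one (A : q → Matrix (Fin D) (Fin D) ℂ) :
    twistedTransferMatrix 1 A = transferMatrix A := by
  simp [twistedTransferMatrix, transferMatrix, Fintype.sum_prod_type, Matrix.one_apply, ite_smul]

/-- Expanding the power gives a sum over pairs of configurations, and the trace of a Kronecker
product splits into a ket amplitude times a conjugate bra amplitude. -/
theorem trace_twistedTransferMatrix_pow (U : Matrix.unitaryGroup q ℂ)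
    (A : q → Matrix (Fin D) (Fin D) ℂ) (n : ℕ) :
    (twistedTransferMatrix (U : Matrix q q ℂ) A ^ n).trace =
      star (mpsState A n) ⬝ᵥ ((tensorUnitary fun _ : Fin n => U : Matrix.unitaryGroup _ ℂ) :
        Matrix (Fin n → q) (Fin n → q) ℂ) *ᵥ mpsState A n := by
  rw [twistedTransferMatrix, sum_pow_eq_sum_list_prod, Matrix.trace_sum,
    ← (Equiv.arrowProdEquivProdArrow (Fin n) (fun _ => q) fun _ => q).symm.sum_comp,
    Fintype.sum_prod_type]
  simp only [dotProduct, Matrix.mulVec, Finset.mul_sum]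
  refine Finset.sum_congr rfl fun s _ => Finset.sum_congr rfl fun t _ => ?_
  simp only [Equiv.arrowProdEquivProdArrow, Equiv.coe_fn_symm_mk]
  rw [list_prod_smul_kronecker, Matrix.trace_smul, Matrix.trace_kronecker,
    trace_list_prod_map_star, tensorUnitary_apply, smul_eq_mul, Pi.star_apply]
  unfold mpsState
  ring

end Transfer

end DihedralLSM

namespace DihedralLSM

/-! ### Injective matrix product states and anticommuting on-site symmetries -/

section NoGo

open Filter Topology

variable {q : Type*} [Fintype q] {D : ℕ}

/-- In the sum of eigenvalue powers the simple dominant eigenvalue contributes exactly its `n`-th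
power, and all others are exponentially smaller; `r` is its modulus. -/
theorem IsInjectiveMPS.exists_tendsto {A : q → Matrix (Fin D) (Fin D) ℂ} (hA : IsInjectiveMPS A) :
    ∃ r : ℝ, 0 < r ∧
      Tendsto (fun n : ℕ => ‖(transferMatrix A ^ n).trace‖ / r ^ n) atTop (𝓝 1) := by
  classical
  obtain ⟨lam, h0, h1, h2⟩ := hA
  refine ⟨‖lam‖, norm_pos_iff.mpr h0, ?_⟩
  set p := (transferMatrix A).charpoly
  have hmem : lam ∈ p.roots.toFinset := by
    rw [Multiset.mem_toFinset, ← Multiset.count_pos, Polynomial.count_roots, h1]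
    exact one_pos
  have hlim : Tendsto (fun n : ℕ => ∑ μ ∈ p.roots.toFinset,
      (p.rootMultiplicity μ : ℂ) * (μ / lam) ^ n) atTop
      (𝓝 (∑ μ ∈ p.roots.toFinset, if μ = lam then 1 else 0)) := by
    refine tendsto_finsetSum _ fun μ hμ => ?_
    split_ifs with h
    · simp [h, h1, h0]
    · have hlt : ‖μ / lam‖ < 1 := by
        rw [norm_div, div_lt_one (norm_pos_iff.mpr h0)]
        exact h2 μ (Polynomial.isRoot_of_mem_roots (Multiset.mem_toFinset.mp hμ)) h
      simpa using (tendsto_pow_atTop_nhds_zero_of_norm_lt_one hlt).const_mul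
        (p.rootMultiplicity μ : ℂ)
  rw [Finset.sum_ite_eq' _ lam, if_pos hmem] at hlim
  have := hlim.norm
  rw [norm_one] at this
  refine this.congr fun n => ?_
  rw [Matrix.trace_pow_eq_sum_roots, ← norm_pow, ← norm_div, Finset.sum_div]
  simp only [div_pow, mul_div_assoc, p]

/-- `tendsto_norm_powerSum` for the eigenvalues divided by `r`, weighted by their multiplicities. It
carries information from lengths divisible by `L` to all lengths. -/
theorem tendsto_norm_trace_pow {ι : Type*} [Fintype ι] [DecidableEq ι] (M : Matrix ι ι ℂ) {r : ℝ}
    (hr : 0 < r) {L : ℕ} (hL : 0 < L)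
    (h : Tendsto (fun k : ℕ => ‖(M ^ (k * L)).trace‖ / r ^ (k * L)) atTop (𝓝 1)) :
    Tendsto (fun n : ℕ => ‖(M ^ n).trace‖ / r ^ n) atTop (𝓝 1) := by
  classical
  have key (n : ℕ) : ‖(M ^ n).trace‖ / r ^ n =
      ‖∑ μ : M.charpoly.roots.toFinset,
        (M.charpoly.rootMultiplicity (μ : ℂ) : ℂ) * ((μ : ℂ) / r) ^ n‖ := by
    rw [Finset.sum_coe_sort M.charpoly.roots.toFinset
      fun μ => (M.charpoly.rootMultiplicity μ : ℂ) * (μ / r) ^ n]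
    simp only [div_pow, ← mul_div_assoc]
    rw [← Finset.sum_div, ← Matrix.trace_pow_eq_sum_roots, norm_div, norm_pow, Complex.norm_real,
      Real.norm_of_nonneg hr.le]
  simp only [key] at h ⊢
  refine tendsto_norm_powerSum _ (fun μ => ?_) _ hL h
  rw [← Polynomial.count_roots, Multiset.count_pos]
  exact Multiset.mem_toFinset.mp μ.2

theorem norm_toEuclideanLin_unitary {ι : Type*} [Fintype ι] [DecidableEq ι]
    (U : Matrix.unitaryGroup ι ℂ) (v : EuclideanSpace ℂ ι) :
    ‖Matrix.toEuclideanLin (U : Matrix ι ι ℂ) v‖ = ‖v‖ := by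
  have h : inner ℂ (Matrix.toEuclideanLin (U : Matrix ι ι ℂ) v)
      (Matrix.toEuclideanLin (U : Matrix ι ι ℂ) v) = inner ℂ v v := by
    rw [EuclideanSpace.inner_eq_star_dotProduct, EuclideanSpace.inner_eq_star_dotProduct,
      dotProduct_comm, dotProduct_comm _ (star v.ofLp)]
    simp only [Matrix.toLpLin_apply]
    rw [Matrix.star_mulVec, ← Matrix.dotProduct_mulVec, Matrix.mulVec_mulVec,
      ← Matrix.star_eq_conjTranspose, Matrix.mem_unitaryGroup_iff'.mp U.2, Matrix.one_mulVec]
  rw [inner_self_eq_norm_sq_to_K, inner_self_eq_norm_sq_to_K] at h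
  have h' : ‖Matrix.toEuclideanLin (U : Matrix ι ι ℂ) v‖ ^ 2 = ‖v‖ ^ 2 := by exact_mod_cast h
  exact (sq_eq_sq₀ (norm_nonneg _) (norm_nonneg _)).mp h'

/-- An injective matrix product state cannot be symmetric under two anticommuting on-site
operators, even if the symmetry is only required for multiples of some unit length. -/
theorem not_isInvariantUpToPhase_of_anticommute [DecidableEq q] (P Q : Matrix.unitaryGroup q ℂ)
    (hPQ : (P * Q : Matrix q q ℂ) = -(Q * P : Matrix q q ℂ))
    {A : q → Matrix (Fin D) (Fin D) ℂ} (hA : IsInjectiveMPS A) {L : ℕ} (hL : 0 < L)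
    (hP : ∀ k : ℕ, 0 < k →
      IsInvariantUpToPhase (tensorUnitary fun _ : Fin (k * L) => P) (mpsState A (k * L)))
    (hQ : ∀ k : ℕ, 0 < k →
      IsInvariantUpToPhase (tensorUnitary fun _ : Fin (k * L) => Q) (mpsState A (k * L))) :
    False := by
  obtain ⟨r, hr, hlim⟩ := hA.exists_tendsto
  have htr (n : ℕ) : (transferMatrix A ^ n).trace = star (mpsState A n) ⬝ᵥ mpsState A n := by
    have h := trace_twistedTransferMatrix_pow (1 : Matrix.unitaryGroup q ℂ) A n
    rwa [tensorUnitary_one, Matrix.UnitaryGroup.one_val, Matrix.UnitaryGroup.one_val,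
      Matrix.one_mulVec, twistedTransferMatrix_one] at h
  have hsym (U : Matrix.unitaryGroup q ℂ) (hU : ∀ k : ℕ, 0 < k →
      IsInvariantUpToPhase (tensorUnitary fun _ : Fin (k * L) => U) (mpsState A (k * L))) :
      Tendsto (fun n : ℕ => ‖(twistedTransferMatrix (U : Matrix q q ℂ) A ^ n).trace‖ / r ^ n)
        atTop (𝓝 1) := by
    refine tendsto_norm_trace_pow _ hr hL ?_
    refine (hlim.comp (tendsto_id.atTop_mul_const' hL)).congr' ?_
    filter_upwards [eventually_gt_atTop 0] with k hk
    obtain ⟨z, hz⟩ := hU k hk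
    simp only [Function.comp, id]
    rw [trace_twistedTransferMatrix_pow, hz, dotProduct_smul, htr, norm_smul, Circle.norm_coe,
      one_mul]
  -- Uniform products of `P` and of `Q` anticommute only on an odd number of sites. For even `L` no
  -- symmetric length is odd, which is why the limits are needed along all `n`.
  have hodd : Tendsto (fun k : ℕ => 2 * k + 1) atTop atTop :=
    tendsto_atTop_mono (fun k => by simp only [id]; omega) tendsto_id
  have hI := (hlim.comp hodd).eventually (Ioo_mem_nhds (show (0.99 : ℝ) < 1 by norm_num)
    (show (1 : ℝ) < 1.01 by norm_num))
  have hP' := ((hsym P hP).comp hodd).eventually (lt_mem_nhds (show (0.99 : ℝ) < 1 by norm_num))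
  have hQ' := ((hsym Q hQ).comp hodd).eventually (lt_mem_nhds (show (0.99 : ℝ) < 1 by norm_num))
  obtain ⟨k, ⟨hk1, hk2⟩, hkP, hkQ⟩ := (hI.and (hP'.and hQ')).exists
  simp only [Function.comp] at hk1 hk2 hkP hkQ
  set n := 2 * k + 1 with hn
  set φ : EuclideanSpace ℂ (Fin n → q) := WithLp.toLp 2 (mpsState A n) with hφ
  have hφnorm : ‖(transferMatrix A ^ n).trace‖ = ‖φ‖ ^ 2 := by
    have h : (transferMatrix A ^ n).trace = inner ℂ φ φ := by
      rw [htr, EuclideanSpace.inner_eq_star_dotProduct, dotProduct_comm]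
    rw [h, inner_self_eq_norm_sq_to_K]
    simp
  have hφU (U : Matrix.unitaryGroup q ℂ) :
      (twistedTransferMatrix (U : Matrix q q ℂ) A ^ n).trace =
        inner ℂ φ (Matrix.toEuclideanLin ((tensorUnitary fun _ : Fin n => U :
          Matrix.unitaryGroup _ ℂ) : Matrix (Fin n → q) (Fin n → q) ℂ) φ) := by
    rw [trace_twistedTransferMatrix_pow, EuclideanSpace.inner_eq_star_dotProduct, dotProduct_comm]
    rfl
  have hrn : 0 < r ^ n := pow_pos hr n
  rw [hφnorm] at hk1 hk2
  rw [lt_div_iff₀ hrn] at hk1 hkP hkQ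
  rw [div_lt_iff₀ hrn] at hk2
  have hφ0 : 0 < ‖φ‖ ^ 2 := by nlinarith
  have hφ1 : 0 < ‖φ‖ := by
    refine lt_of_le_of_ne (norm_nonneg _) fun h => ?_
    simp [← h] at hφ0
  set ψ : EuclideanSpace ℂ (Fin n → q) := ((‖φ‖⁻¹ : ℝ) : ℂ) • φ
  have hψ : ‖ψ‖ = 1 := by
    rw [norm_smul, Complex.norm_real, norm_inv, norm_norm, inv_mul_cancel₀ hφ1.ne']
  have hψU (U : Matrix.unitaryGroup q ℂ)
      (hU : 0.99 * r ^ n < ‖(twistedTransferMatrix (U : Matrix q q ℂ) A ^ n).trace‖) :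
      3 / 4 < ‖inner ℂ ψ (Matrix.toEuclideanLin ((tensorUnitary fun _ : Fin n => U :
        Matrix.unitaryGroup _ ℂ) : Matrix (Fin n → q) (Fin n → q) ℂ) ψ)‖ ^ 2 := by
    rw [hφU] at hU
    rw [map_smul, inner_smul_left, inner_smul_right, Complex.conj_ofReal, norm_mul, norm_mul,
      Complex.norm_real, norm_inv, norm_norm, ← mul_assoc, ← mul_inv, ← sq, inv_mul_eq_div]
    set b := ‖inner ℂ φ (Matrix.toEuclideanLin ((tensorUnitary fun _ : Fin n => U :
        Matrix.unitaryGroup _ ℂ) : Matrix (Fin n → q) (Fin n → q) ℂ) φ)‖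
    -- The ratio exceeds `0.99 / 1.01 > 0.9`, and `0.9 ^ 2 > 3 / 4`.
    have hb : 0.9 < b / ‖φ‖ ^ 2 := by
      rw [lt_div_iff₀ hφ0]
      linarith
    nlinarith
  refine absurd (hψU Q hkQ) (not_lt.mpr (norm_inner_sq_le_of_anticommute _ _
    (norm_toEuclideanLin_unitary _) (norm_toEuclideanLin_unitary _) (fun v => ?_) hψ (hψU P hkP)))
  have hT : ((tensorUnitary (fun _ : Fin n => P) * tensorUnitary fun _ : Fin n => Q :
      Matrix.unitaryGroup _ ℂ) : Matrix (Fin n → q) (Fin n → q) ℂ) =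
      -((tensorUnitary (fun _ : Fin n => Q) * tensorUnitary fun _ : Fin n => P :
      Matrix.unitaryGroup _ ℂ) : Matrix (Fin n → q) (Fin n → q) ℂ) := by
    rw [tensorUnitary_mul, tensorUnitary_mul,
      tensorUnitary_smul (U := fun _ : Fin n => P * Q) (V := fun _ => Q * P) (z := fun _ => -1)
        (fun _ => by simpa using hPQ), hn]
    simp [pow_succ]
  simp only [Matrix.toLpLin_apply, Matrix.mulVec_mulVec, ← Matrix.UnitaryGroup.mul_val, hT,
    Matrix.neg_mulVec]
  rfl

end NoGo

end DihedralLSM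

namespace DihedralLSM

/-! ### Matrix entries of the one-site operators -/

section SiteOp

variable (N : ℕ) [NeZero N]

theorem shift_zpow_apply (k : ℤ) (s t : ZMod N) :
    (shift N ^ k : Matrix.unitaryGroup (ZMod N) ℂ) s t = if s = t + k then 1 else 0 := by
  induction k generalizing s t with
  | zero => simp [Matrix.one_apply]
  | succ k ih =>
    rw [zpow_add_one, Matrix.UnitaryGroup.mul_val, Matrix.mul_apply]
    simp only [ih]
    simp [shift, add_comm, add_left_comm]
  | pred k ih =>
    rw [zpow_sub_one, Matrix.UnitaryGroup.mul_val, Matrix.mul_apply]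
    simp only [ih, Matrix.UnitaryGroup.inv_val, Matrix.star_apply]
    have h : ∀ x : ZMod N, (t = x + 1) ↔ x = t - 1 := fun x =>
      ⟨fun h => by rw [h]; ring, fun h => by rw [h]; ring⟩
    simp only [shift, Matrix.of_apply, h]
    simp only [apply_ite star, star_one, star_zero, mul_ite, mul_one, mul_zero,
      Finset.sum_ite_eq', Finset.mem_univ, if_true]
    congr 2
    push_cast
    ring

theorem shift_zpow_congr {k l : ℤ} (h : (k : ZMod N) = l) : shift N ^ k = shift N ^ l := by
  ext s t
  rw [shift_zpow_apply, shift_zpow_apply, h]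

theorem chargeConj_mul_clock_apply (s t : ZMod N) :
    (chargeConj N * clock N : Matrix.unitaryGroup (ZMod N) ℂ) s t =
      if s = -t then ((ZMod.toCircle t : Circle) : ℂ) else 0 := by
  simp [chargeConj, clock]

variable (a : ℤ) (j : ℕ)

theorem siteOp_r_apply (i s t : ZMod N) :
    siteOp N a j (.r i) s t = if s = t + a ^ j * i then 1 else 0 := by
  simp [siteOp, shift_zpow_apply]

theorem siteOp_sr_apply (i s t : ZMod N) :
    siteOp N a j (.sr i) s t =
      if s = -(t + a ^ j * i) then ((ZMod.toCircle (t + (a : ZMod N) ^ j * i) : Circle) : ℂ) else 0 := by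
  rw [siteOp, Matrix.UnitaryGroup.mul_val, Matrix.mul_apply]
  simp only [shift_zpow_apply, chargeConj_mul_clock_apply]
  simp

/-- The exponent of the rotation `x` in the normal form `x ^ i` or `c x ^ i`. -/
def rotationExponent : DihedralGroup N → ZMod N
  | .r i => i
  | .sr i => i

/-- The factor system of the one-site operators. -/
noncomputable def siteCocycle : DihedralGroup N × DihedralGroup N → Circle
  | (_, .r _) => 1
  | (g, .sr _) => ZMod.toCircle ((a : ZMod N) ^ j * rotationExponent N g)

/-- Moving `X ^ k` to the right past `C Z` turns it into `X ^ (-k)` and produces the phase `toCircle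
k`. No other phase arises, because `C Z` squares to `1`. -/
theorem isFactorSystem_siteCocycle : IsFactorSystem (siteOp N a j) (siteCocycle N a j) := by
  rintro (i | i) (k | k) <;> ext s t <;>
    simp only [Matrix.mul_apply, Matrix.smul_apply, siteOp_r_apply, siteOp_sr_apply,
      DihedralGroup.r_mul_r, DihedralGroup.r_mul_sr, DihedralGroup.sr_mul_r,
      DihedralGroup.sr_mul_sr, siteCocycle, rotationExponent, mul_ite, mul_zero, ite_mul,
      zero_mul, Finset.sum_ite_eq', Finset.mem_univ, if_true, smul_eq_mul, mul_one, one_mul,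
      Circle.coe_one, ← Circle.coe_mul, ← AddChar.map_add_eq_mul] <;>
    ring_nf

variable {N a j}

theorem siteOp_succ (g : DihedralGroup N) :
    siteOp N a (j + 1) g = siteOp N a j (translation N a g) := by
  rcases g with i | i
  · change shift N ^ _ = shift N ^ _
    exact shift_zpow_congr N (by simp [pow_succ, mul_assoc])
  · change _ * shift N ^ _ = _ * shift N ^ _
    exact congrArg _ (shift_zpow_congr N (by simp [pow_succ, mul_assoc]))

theorem translation_bijective (ha : IsCoprime a (N : ℤ)) :
    Function.Bijective (translation N a) := by
  rw [← Finite.injective_iff_bijective]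
  have hu : IsUnit (a : ZMod N) := by
    obtain ⟨u, v, h⟩ := ha
    have h' := congrArg (Int.cast : ℤ → ZMod N) h
    push_cast at h'
    rw [ZMod.natCast_self, mul_zero, add_zero] at h'
    exact IsUnit.of_mul_eq_one_right _ h'
  rintro (i | i) (k | k) h
  · exact congrArg _ (hu.mul_left_cancel (DihedralGroup.r.inj h))
  · cases h
  · cases h
  · exact congrArg _ (hu.mul_left_cancel (DihedralGroup.sr.inj h))

end SiteOp

/-! ### Factor systems and cocycles -/

section Cocycle

theorem smul_unitary_injective {q : Type*} [Fintype q] [DecidableEq q] [Nonempty q]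
    (U : Matrix.unitaryGroup q ℂ) {z w : ℂ}
    (h : z • (U : Matrix q q ℂ) = w • (U : Matrix q q ℂ)) : z = w := by
  have h1 := congrArg (· * star (U : Matrix q q ℂ)) h
  simp only [Matrix.smul_mul, Matrix.mem_unitaryGroup_iff.mp U.2] at h1
  have i : q := Classical.arbitrary q
  simpa using congrFun (congrFun h1 i) i

variable {G : Type*} [Group G]

theorem isCocycle_iff {ω : G × G → Circle} :
    IsCocycle ω ↔ ∀ g h j : G, ω (g * h, j) * ω (g, h) = ω (h, j) * ω (g, h * j) := Iff.rfl

theorem cohomologous_iff {ω ω' : G × G → Circle} :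
    Cohomologous ω ω' ↔ ∃ f : G → Circle, ∀ g h : G,
      f h / f (g * h) * f g = ω (g, h) / ω' (g, h) := Iff.rfl

section FactorSystem

variable {q : Type*} [Fintype q] [DecidableEq q] [Nonempty q] {U : G → Matrix.unitaryGroup q ℂ}
  {ν : G × G → Circle}

theorem IsFactorSystem.isCocycle (h : IsFactorSystem U ν) : IsCocycle ν := by
  rw [isCocycle_iff]
  intro g k l
  apply Circle.ext
  apply smul_unitary_injective (U (g * k * l))
  have h1 : (U g : Matrix q q ℂ) * U k * U l =
      ((ν (g * k, l) * ν (g, k) : Circle) : ℂ) • (U (g * k * l) : Matrix q q ℂ) := by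
    rw [h g k, Matrix.smul_mul, h, smul_smul, Circle.coe_mul, mul_comm]
  have h2 : (U g : Matrix q q ℂ) * (U k * U l) =
      ((ν (k, l) * ν (g, k * l) : Circle) : ℂ) • (U (g * k * l) : Matrix q q ℂ) := by
    rw [h k l, Matrix.mul_smul, h, smul_smul, Circle.coe_mul, mul_assoc]
  rw [← h1, ← h2, mul_assoc]

theorem IsFactorSystem.unique {ν' : G × G → Circle} (h : IsFactorSystem U ν)
    (h' : IsFactorSystem U ν') : ν = ν' := by
  ext ⟨g, k⟩
  exact smul_unitary_injective (U (g * k)) ((h g k).symm.trans (h' g k))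

end FactorSystem

/-- For commuting elements, `ω (g, h) / ω (h, g)` is the commutator of lifts to the central
extension. It is multiplicative in `g`, so its square is the commutator belonging to `g * g = 1`. -/
theorem IsCocycle.sq_eq_sq_of_commute {ω : G × G → Circle} (hω : IsCocycle ω) {g h : G}
    (hgh : Commute g h) (hg : g * g = 1) : ω (g, h) ^ 2 = ω (h, g) ^ 2 := by
  rw [isCocycle_iff] at hω
  have h1 := hω g g h
  have h2 := hω g h g
  have h3 := hω h g g
  -- The cocycle need not be normalised, so its values at the identity are carried along as `ω (1,
  -- 1)`.
  have e1 : ω (1, h) = ω (1, 1) := by simpa using (hω 1 1 h).symm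
  have e2 : ω (h, 1) = ω (1, 1) := by simpa using hω h 1 1
  rw [hg, e1] at h1
  rw [hg, e2] at h3
  rw [hgh.eq] at h1 h2
  have h4 : ω (h * g, g) * ω (h, g) = ω (g, h) * ω (g, h * g) := by rw [h3, ← h1, mul_comm]
  apply mul_left_cancel (a := ω (h * g, g) * ω (g, h * g))
  calc _ = (ω (g, h) * ω (g, h * g)) * (ω (h * g, g) * ω (g, h)) := by rw [sq]; ac_rfl
    _ = (ω (h * g, g) * ω (h, g)) * (ω (h, g) * ω (g, h * g)) := by rw [h4, h2]
    _ = _ := by rw [sq]; ac_rfl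

end Cocycle

/-! ### The half-turn phase -/

section HalfTurn

variable {N : ℕ}

theorem half_add_half (hN : Even N) : ((N / 2 : ℕ) : ZMod N) + ((N / 2 : ℕ) : ZMod N) = 0 := by
  rw [← Nat.cast_add, ← two_mul, Nat.mul_div_cancel' hN.two_dvd, ZMod.natCast_self]

theorem odd_mul_half (hN : Even N) {a : ℤ} (ha : Odd a) :
    (a : ZMod N) * ((N / 2 : ℕ) : ZMod N) = ((N / 2 : ℕ) : ZMod N) := by
  obtain ⟨b, rfl⟩ := ha
  push_cast
  linear_combination (b : ZMod N) * half_add_half hN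

theorem toCircle_half [NeZero N] (hN : Even N) :
    ((ZMod.toCircle ((N / 2 : ℕ) : ZMod N) : Circle) : ℂ) = -1 := by
  obtain ⟨k, rfl⟩ := hN
  have hk : (k : ℂ) ≠ 0 := by
    have := NeZero.ne (k + k)
    exact_mod_cast fun h => this (by omega)
  rw [ZMod.toCircle_natCast, ← Complex.exp_pi_mul_I, ← two_mul, Nat.mul_div_cancel_left _ two_pos]
  congr 1
  push_cast
  field_simp

theorem commute_half (hN : Even N) :
    Commute (.r ((N / 2 : ℕ) : ZMod N)) (.sr 0 : DihedralGroup N) := by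
  rw [Commute, SemiconjBy, DihedralGroup.r_mul_sr, DihedralGroup.sr_mul_r, zero_add, zero_sub,
    neg_eq_of_add_eq_zero_left (half_add_half hN)]

theorem halfTurnPhase_mul (ω ω' : DihedralGroup N × DihedralGroup N → Circle) :
    halfTurnPhase (ω * ω') = halfTurnPhase ω * halfTurnPhase ω' := by
  simp only [halfTurnPhase, Pi.mul_apply, ← Circle.coe_mul, mul_div_mul_comm]

theorem halfTurnPhase_ne_zero (ω : DihedralGroup N × DihedralGroup N → Circle) :
    halfTurnPhase ω ≠ 0 := Circle.coe_ne_zero _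

/-- A coboundary is symmetric on commuting pairs, and the half turn commutes with `c`; it therefore
cancels in the quotient. -/
theorem halfTurnPhase_congr (hN : Even N) {ω ω' : DihedralGroup N × DihedralGroup N → Circle}
    (h : Cohomologous ω ω') : halfTurnPhase ω = halfTurnPhase ω' := by
  obtain ⟨f, hf⟩ := cohomologous_iff.mp h
  have h1 := hf (.r ((N / 2 : ℕ) : ZMod N)) (.sr 0)
  have h2 := hf (.sr 0) (.r ((N / 2 : ℕ) : ZMod N))
  rw [(commute_half hN).eq, div_mul_eq_mul_div, mul_comm (f _), ← div_mul_eq_mul_div, h2] at h1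
  refine congrArg (fun z : Circle => (z : ℂ)) ?_
  rw [div_eq_div_iff_mul_eq_mul] at h1 ⊢
  rw [← h1, mul_comm]

theorem IsCocycle.halfTurnPhase_eq (hN : Even N)
    {ω : DihedralGroup N × DihedralGroup N → Circle} (hω : IsCocycle ω) :
    halfTurnPhase ω = 1 ∨ halfTurnPhase ω = -1 := by
  rw [← sq_eq_one_iff, halfTurnPhase, ← Circle.coe_pow, div_pow,
    hω.sq_eq_sq_of_commute (commute_half hN), div_self', Circle.coe_one]
  rw [DihedralGroup.r_mul_r, half_add_half hN, DihedralGroup.r_zero]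

variable {a : ℤ}

/-- A factor system is determined by its operators, so the explicit one may be used. Its phase is
`toCircle (a ^ j * (N/2))`, and the odd factor drops out. -/
theorem halfTurnPhase_siteOp [NeZero N] (hN : Even N) (ha : Odd a) {j : ℕ}
    {ν : DihedralGroup N × DihedralGroup N → Circle} (hν : IsFactorSystem (siteOp N a j) ν) :
    halfTurnPhase ν = -1 := by
  rw [hν.unique (isFactorSystem_siteCocycle N a j)]
  simp only [halfTurnPhase, siteCocycle, rotationExponent, div_one]
  rw [← Int.cast_pow, odd_mul_half hN ha.pow, toCircle_half hN]

theorem halfTurnPhase_pullback (hN : Even N) (ha : Odd a)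
    (ω : DihedralGroup N × DihedralGroup N → Circle) (j : ℕ) :
    halfTurnPhase (pullback (translation N a)^[j] ω) = halfTurnPhase ω := by
  have h1 : (translation N a)^[j] (.r ((N / 2 : ℕ) : ZMod N)) = .r ((N / 2 : ℕ) : ZMod N) :=
    Function.iterate_fixed (congrArg DihedralGroup.r (odd_mul_half hN ha)) j
  have h2 : (translation N a)^[j] (.sr 0) = .sr 0 :=
    Function.iterate_fixed (congrArg DihedralGroup.sr (mul_zero _)) j
  simp only [halfTurnPhase, pullback, h1, h2]

theorem not_isCoboundary_of_halfTurnPhase (hN : Even N)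
    {ω : DihedralGroup N × DihedralGroup N → Circle} (hω : halfTurnPhase ω = -1) :
    ¬ IsCoboundary ω := by
  intro h
  have h1 : Cohomologous ω 1 := by rwa [Cohomologous, div_one]
  rw [halfTurnPhase_congr hN h1] at hω
  norm_num [halfTurnPhase] at hω

end HalfTurn

end DihedralLSM

namespace DihedralLSM

/-! ### The global symmetry -/

section Chain

variable {N : ℕ}

theorem dihedralGroup_closure [NeZero N] :
    Subgroup.closure {(.r 1 : DihedralGroup N), .sr 0} = ⊤ := by
  rw [Subgroup.eq_top_iff']
  have hr (i : ZMod N) : DihedralGroup.r i ∈ Subgroup.closure {(.r 1 : DihedralGroup N), .sr 0} := by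
    have h := Subgroup.pow_mem _ (Subgroup.subset_closure
      (Set.mem_insert (.r 1 : DihedralGroup N) {.sr 0})) i.val
    rwa [DihedralGroup.r_one_pow, ZMod.natCast_zmod_val] at h
  rintro (i | i)
  · exact hr i
  · have hs : (.sr 0 : DihedralGroup N) ∈ Subgroup.closure {(.r 1 : DihedralGroup N), .sr 0} :=
      Subgroup.subset_closure (by simp)
    have h := Subgroup.mul_mem _ hs (hr i)
    rwa [DihedralGroup.sr_mul_r, zero_add] at h

theorem range_eq_closure [NeZero N] {H : Type*} [Group H] (f : DihedralGroup N →* H) :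
    f.range = Subgroup.closure {f (.r 1), f (.sr 0)} := by
  rw [MonoidHom.range_eq_map, ← dihedralGroup_closure, MonoidHom.map_closure, Set.image_pair]

/-- An injective homomorphism from the dihedral group is an isomorphism onto the group generated by
the images of the two generators. -/
theorem exists_mulEquiv_of_injective [NeZero N] {H : Type*} [Group H] (f : DihedralGroup N →* H)
    (hf : Function.Injective f) {x c : H} (hx : f (.r 1) = x) (hc : f (.sr 0) = c)
    {K : Subgroup H} (hK : K = Subgroup.closure {x, c}) :
    ∃ e : DihedralGroup N ≃* K, (e (.r 1) : H) = x ∧ (e (.sr 0) : H) = c := by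
  subst hx hc
  rw [← range_eq_closure] at hK
  subst hK
  exact ⟨MonoidHom.ofInjective hf, rfl, rfl⟩

variable [NeZero N] (a : ℤ) (L : ℕ)

/-- The dihedral group acting on a unit cell of `L` sites. -/
noncomputable def cellOp (g : DihedralGroup N) : Matrix.unitaryGroup (Fin L → ZMod N) ℂ :=
  tensorUnitary fun i => siteOp N a i g

/-- The factor system of the action on a unit cell. -/
noncomputable def cellCocycle (p : DihedralGroup N × DihedralGroup N) : Circle :=
  ∏ i : Fin L, siteCocycle N a i p

theorem isFactorSystem_cellOp :
    IsFactorSystem (cellOp (N := N) a L) (cellCocycle a L) := by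
  intro g h
  rw [← Matrix.UnitaryGroup.mul_val, cellOp, cellOp, tensorUnitary_mul,
    tensorUnitary_smul (z := fun i : Fin L => (siteCocycle N a i (g, h) : ℂ))
      (fun i => isFactorSystem_siteCocycle N a i g h), cellCocycle]
  congr 1
  exact (map_prod Circle.coeHom _ _).symm

/-- The site phases multiply, so their exponents add up; this is where the sum of the `a ^ j`
enters. -/
theorem cellCocycle_sr (g : DihedralGroup N) (k : ZMod N) :
    cellCocycle a L (g, .sr k) =
      ZMod.toCircle (((∑ j ∈ Finset.range L, a ^ j : ℤ) : ZMod N) * rotationExponent N g) := by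
  have h (f : Fin L → ZMod N) : ZMod.toCircle (∑ i, f i) = ∏ i, ZMod.toCircle (f i) :=
    map_prod (ZMod.toCircle (N := N)).toMonoidHom (fun i => Multiplicative.ofAdd (f i)) Finset.univ
  rw [← Fin.sum_univ_eq_sum_range, Int.cast_sum, Finset.sum_mul, h]
  simp [cellCocycle, siteCocycle]

theorem cellCocycle_r (g : DihedralGroup N) (k : ZMod N) : cellCocycle a L (g, .r k) = 1 := by
  simp [cellCocycle, siteCocycle]

theorem one_lt_of_even (hN : Even N) : 1 < N := by
  obtain ⟨k, rfl⟩ := hN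
  have := NeZero.ne (k + k)
  omega

theorem cellOp_r_one (hN : Even N) : cellOp a L (.r 1 : DihedralGroup N) = symX N a L L := by
  have : Fact (1 < N) := ⟨one_lt_of_even hN⟩
  unfold cellOp symX
  congr 1
  ext1 i
  rw [Nat.mod_eq_of_lt i.2, siteOp, ZMod.val_one, Nat.cast_one, mul_one]

theorem cellOp_sr_zero : cellOp a L (.sr 0 : DihedralGroup N) = symC N L := by
  simp [cellOp, symC, siteOp]

variable {L}

/-- A phase has no vanishing diagonal entry. The first site, where the modulation exponent is `a ^ 0
= 1`, already rules out everything except the identity and `c`. -/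
theorem eq_one_of_cellOp_mem_phases (hN : Even N) (hL : 0 < L) {g : DihedralGroup N}
    (hg : cellOp a L g ∈ phases (Fin L → ZMod N)) : g = 1 := by
  have : Fact (1 < N) := ⟨one_lt_of_even hN⟩
  obtain ⟨z, hz⟩ := hg
  have happ (s : Fin L → ZMod N) : ∏ i : Fin L, siteOp N a i g (s i) (s i) = (z : ℂ) := by
    rw [← tensorUnitary_apply]
    refine (congrFun (congrFun hz s) s).trans ?_
    simp
  have hfac (s : Fin L → ZMod N) (i : Fin L) : siteOp N a i g (s i) (s i) ≠ 0 := fun h =>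
    z.coe_ne_zero ((happ s).symm.trans (Finset.prod_eq_zero (Finset.mem_univ i) h))
  set o : Fin L := ⟨0, hL⟩
  rcases g with k | k
  · have h := hfac 0 o
    rw [siteOp_r_apply, Pi.zero_apply, pow_zero, one_mul, zero_add] at h
    have hk : 0 = k := by simpa using h
    rw [← hk, DihedralGroup.r_zero]
  · have h := hfac 0 o
    rw [siteOp_sr_apply, Pi.zero_apply, pow_zero, one_mul, zero_add] at h
    have hk : k = 0 := by
      by_contra hk
      exact h (if_neg fun h' => hk (neg_eq_zero.mp h'.symm))
    subst hk
    have hz1 : (z : ℂ) = 1 := by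
      rw [← happ 0]
      simp [siteOp_sr_apply]
    -- To exclude `c`, compare with the zero configuration, whose diagonal entry is `1`. Exciting
    -- one site to `1` gives the entry `toCircle 1` if `1 = -1` (that is, `N = 2`) and `0`
    -- otherwise, never `1`.
    have h1 := happ (Pi.single o 1)
    rw [Finset.prod_eq_single o] at h1
    · rw [hz1, siteOp_sr_apply, Pi.single_eq_same, mul_zero, add_zero] at h1
      split_ifs at h1
      · have h2 : ZMod.toCircle (1 : ZMod N) = ZMod.toCircle (0 : ZMod N) := by
          rw [AddChar.map_zero_eq_one]
          exact Circle.ext h1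
        exact absurd (ZMod.injective_toCircle h2) one_ne_zero
      · exact absurd h1 zero_ne_one
    · intro i _ hi
      rw [siteOp_sr_apply, Pi.single_eq_of_ne hi]
      simp
    · simp

theorem exists_mulEquiv_projective (hN : Even N) (hL : 0 < L) :
    ∃ e : DihedralGroup N ≃* (Subgroup.closure {symX N a L L, symC N L}).map
        (QuotientGroup.mk' (phases (Fin L → ZMod N))),
      (e (.r 1) : _ ⧸ phases (Fin L → ZMod N)) = symX N a L L ∧
      (e (.sr 0) : _ ⧸ phases (Fin L → ZMod N)) = symC N L := by
  let f : DihedralGroup N →* (Matrix.unitaryGroup (Fin L → ZMod N) ℂ ⧸ phases (Fin L → ZMod N)) :=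
    MonoidHom.mk' (fun g => QuotientGroup.mk' (phases (Fin L → ZMod N)) (cellOp a L g)) (by
      intro g h
      rw [← map_mul]
      refine (QuotientGroup.eq).mpr ⟨cellCocycle a L (g, h), ?_⟩
      rw [Matrix.UnitaryGroup.mul_val, Matrix.UnitaryGroup.mul_val, isFactorSystem_cellOp,
        Matrix.mul_smul, ← Matrix.UnitaryGroup.mul_val, inv_mul_cancel,
        Matrix.UnitaryGroup.one_val])
  refine exists_mulEquiv_of_injective f ?_ ?_ ?_ ?_
  · rw [injective_iff_map_eq_one]
    intro g hg
    exact eq_one_of_cellOp_mem_phases a hN hL ((QuotientGroup.eq_one_iff _).mp hg)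
  · exact congrArg (QuotientGroup.mk' (phases (Fin L → ZMod N))) (cellOp_r_one a L hN)
  · exact congrArg (QuotientGroup.mk' (phases (Fin L → ZMod N))) (cellOp_sr_zero a L)
  · rw [MonoidHom.map_closure, Set.image_pair]
    rfl

theorem exists_mulEquiv_linear_iff (hN : Even N) (hL : 0 < L) :
    (∃ e : DihedralGroup N ≃* Subgroup.closure {symX N a L L, symC N L},
      (e (.r 1) : Matrix.unitaryGroup (Fin L → ZMod N) ℂ) = symX N a L L ∧
      (e (.sr 0) : Matrix.unitaryGroup (Fin L → ZMod N) ℂ) = symC N L) ↔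
      (N : ℤ) ∣ ∑ j ∈ Finset.range L, a ^ j := by
  rw [← ZMod.intCast_zmod_eq_zero_iff_dvd]
  constructor
  · rintro ⟨e, hx, hc⟩
    -- The relation `x c x = c` detects the obstruction: on operators it holds up to `toCircle` of
    -- the sum of the `a ^ j`, and `toCircle` is injective.
    have h0 : e (.r 1) * e (.sr 0) * e (.r 1) = e (.sr 0) := by
      rw [← map_mul, ← map_mul, DihedralGroup.r_mul_sr, DihedralGroup.sr_mul_r, zero_sub,
        neg_add_cancel]
    have h1 := congrArg (Subtype.val : _ → Matrix.unitaryGroup (Fin L → ZMod N) ℂ) h0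
    rw [Subgroup.coe_mul, Subgroup.coe_mul, hx, hc] at h1
    have h2 := congrArg (Subtype.val : _ → Matrix (Fin L → ZMod N) (Fin L → ZMod N) ℂ) h1
    rw [← cellOp_r_one a L hN, ← cellOp_sr_zero a L, Matrix.UnitaryGroup.mul_val,
      Matrix.UnitaryGroup.mul_val, isFactorSystem_cellOp, Matrix.smul_mul, isFactorSystem_cellOp,
      cellCocycle_r, Circle.coe_one, one_smul, DihedralGroup.r_mul_sr, DihedralGroup.sr_mul_r,
      zero_sub, neg_add_cancel] at h2
    have h3 := smul_unitary_injective (cellOp a L (.sr 0 : DihedralGroup N)) (w := 1)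
      (h2.trans (one_smul ℂ _).symm)
    rw [cellCocycle_sr, rotationExponent, mul_one] at h3
    apply ZMod.injective_toCircle (N := N)
    rw [AddChar.map_zero_eq_one]
    exact Circle.ext h3
  · intro h
    have hone (p : DihedralGroup N × DihedralGroup N) : cellCocycle a L p = 1 := by
      obtain ⟨g, k | k⟩ := p
      · exact cellCocycle_r a L g k
      · rw [cellCocycle_sr, h, zero_mul, AddChar.map_zero_eq_one]
    let f : DihedralGroup N →* Matrix.unitaryGroup (Fin L → ZMod N) ℂ :=
      MonoidHom.mk' (cellOp a L) (by
        intro g k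
        apply Subtype.ext
        rw [Matrix.UnitaryGroup.mul_val, isFactorSystem_cellOp, hone, Circle.coe_one, one_smul])
    refine exists_mulEquiv_of_injective f ?_ (cellOp_r_one a L hN) (cellOp_sr_zero a L) rfl
    rw [injective_iff_map_eq_one]
    intro g hg
    refine eq_one_of_cellOp_mem_phases a hN hL ?_
    rw [show cellOp a L g = 1 from hg]
    exact one_mem _

variable {a}

/-- Odd exponents are invisible to the half turn, so this power of the modulated symmetry is uniform
along the chain. -/
theorem symX_pow_half (hN : Even N) (ha : Odd a) (n : ℕ) :
    symX N a L n ^ (N / 2) = tensorUnitary fun _ => shift N ^ (((N / 2 : ℕ) : ℤ)) := by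
  rw [symX, tensorUnitary_pow]
  congr 1
  ext1 i
  rw [← zpow_natCast, ← zpow_mul]
  apply shift_zpow_congr
  rw [Int.cast_mul, Int.cast_natCast, odd_mul_half hN ha.pow]

theorem shift_half_anticommute (hN : Even N) :
    ((shift N ^ ((N / 2 : ℕ) : ℤ) : Matrix.unitaryGroup (ZMod N) ℂ) *
        (chargeConj N * clock N : Matrix.unitaryGroup (ZMod N) ℂ) : Matrix (ZMod N) (ZMod N) ℂ) =
      -((chargeConj N * clock N : Matrix.unitaryGroup (ZMod N) ℂ) *
        (shift N ^ ((N / 2 : ℕ) : ℤ) : Matrix.unitaryGroup (ZMod N) ℂ) :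
          Matrix (ZMod N) (ZMod N) ℂ) := by
  ext s t
  rw [Matrix.neg_apply, Matrix.mul_apply, Matrix.mul_apply]
  simp only [shift_zpow_apply, chargeConj_mul_clock_apply, mul_ite, mul_zero, ite_mul, zero_mul,
    Finset.sum_ite_eq', Finset.mem_univ, if_true, mul_one, one_mul, Int.cast_natCast]
  rw [AddChar.map_add_eq_mul, Circle.coe_mul, toCircle_half hN, neg_add,
    neg_eq_of_add_eq_zero_left (half_add_half hN)]
  split_ifs <;> simp

theorem not_exists_symmetric_injective_MPS (hN : Even N) (ha : Odd a) (hL : 0 < L) :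
    ¬ ∃ (D : ℕ) (A : ZMod N → Matrix (Fin D) (Fin D) ℂ),
      IsInjectiveMPS A ∧ IsSymmetricMPS N a L A := by
  rintro ⟨D, A, hA, hsym⟩
  refine not_isInvariantUpToPhase_of_anticommute _ _ (shift_half_anticommute hN) hA hL
    (fun k hk => ?_) fun k hk => (hsym k hk).2
  rw [← symX_pow_half (L := L) hN ha]
  exact (hsym k hk).1.pow _

end Chain

theorem odd_of_isCoprime {N : ℕ} (hN : Even N) {a : ℤ} (ha : IsCoprime a (N : ℤ)) : Odd a := by
  rw [← Int.isCoprime_two_right]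
  exact ha.of_isCoprime_of_dvd_right (by exact_mod_cast hN.two_dvd)

theorem not_modEq_one {a : ℤ} (ha : Odd a) (m : ℤ) : ¬ m * (a - 1) ≡ 1 [ZMOD 2] := by
  obtain ⟨b, rfl⟩ := ha
  intro h
  have h1 : m * (2 * b + 1 - 1) = 2 * (m * b) := by ring
  rw [h1, Int.ModEq] at h
  omega

end DihedralLSM

theorem mainTheorem7 (N : ℕ) [NeZero N] (hN : Even N) (a : ℤ) (ha : IsCoprime a (N : ℤ))
    (L : ℕ) (hL : 0 < L) :
    -- modulo global phases, the two symmetries generate the dihedral group of order `2 N`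
    (∃ e : DihedralGroup N ≃*
        (Subgroup.closure {DihedralLSM.symX N a L L, DihedralLSM.symC N L}).map
          (QuotientGroup.mk' (DihedralLSM.phases (Fin L → ZMod N))),
      (e (.r 1) : _ ⧸ DihedralLSM.phases (Fin L → ZMod N)) = DihedralLSM.symX N a L L ∧
      (e (.sr 0) : _ ⧸ DihedralLSM.phases (Fin L → ZMod N)) = DihedralLSM.symC N L) ∧
    -- without dividing by phases, this holds exactly when the exponents sum up to `0` modulo `N`
    ((∃ e : DihedralGroup N ≃*
        Subgroup.closure {DihedralLSM.symX N a L L, DihedralLSM.symC N L},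
      (e (.r 1) : Matrix.unitaryGroup (Fin L → ZMod N) ℂ) = DihedralLSM.symX N a L L ∧
      (e (.sr 0) : Matrix.unitaryGroup (Fin L → ZMod N) ℂ) = DihedralLSM.symC N L) ↔
      (N : ℤ) ∣ ∑ j ∈ Finset.range L, a ^ j) ∧
    -- translation by one site acts on the dihedral group by the automorphism `x ↦ x ^ a`, `c ↦ c`
    (Function.Bijective (DihedralLSM.translation N a) ∧
      ∀ (j : ℕ) (g : DihedralGroup N), DihedralLSM.siteOp N a (j + 1) g =
        DihedralLSM.siteOp N a j (DihedralLSM.translation N a g)) ∧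
    -- every site carries a projective representation of nontrivial class
    (∀ j : ℕ, ∃ ν : DihedralGroup N × DihedralGroup N → Circle,
      DihedralLSM.IsFactorSystem (DihedralLSM.siteOp N a j) ν ∧
      DihedralLSM.IsCocycle ν ∧
      DihedralLSM.halfTurnPhase ν = (-1) ^ (a ^ j) ∧
      DihedralLSM.halfTurnPhase ν = -1 ∧
      ¬ DihedralLSM.IsCoboundary ν) ∧
    -- the invariant of a class on the bonds is a sign, and depends on the class only
    (∀ ω : DihedralGroup N × DihedralGroup N → Circle, DihedralLSM.IsCocycle ω →
      (∃ m : ℤ, (m = 0 ∨ m = 1) ∧ DihedralLSM.halfTurnPhase ω = (-1) ^ m) ∧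
      ∀ ω' : DihedralGroup N × DihedralGroup N → Circle, DihedralLSM.Cohomologous ω' ω →
        DihedralLSM.halfTurnPhase ω' = DihedralLSM.halfTurnPhase ω) ∧
    -- for the class with invariant `(-1) ^ m` on the first bond, consistency reads `m (a - 1) ≡ 1`
    (∀ ω : DihedralGroup N × DihedralGroup N → Circle, DihedralLSM.IsCocycle ω →
      ∀ m : ℤ, DihedralLSM.halfTurnPhase ω = (-1) ^ m →
      ∀ (j : ℕ) (ν : DihedralGroup N × DihedralGroup N → Circle),
        DihedralLSM.IsFactorSystem (DihedralLSM.siteOp N a j) ν →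
        DihedralLSM.halfTurnPhase (DihedralLSM.pullback (DihedralLSM.translation N a)^[j] ω) =
          (-1) ^ (m * a ^ j) ∧
        (DihedralLSM.halfTurnPhase
            (DihedralLSM.pullback (DihedralLSM.translation N a)^[j + 1] ω) =
          DihedralLSM.halfTurnPhase
            (ν * DihedralLSM.pullback (DihedralLSM.translation N a)^[j] ω) ↔
          m * (a - 1) ≡ 1 [ZMOD 2])) ∧
    -- this congruence has no solution
    (¬ ∃ m : ℤ, m * (a - 1) ≡ 1 [ZMOD 2]) ∧
    -- so no classes on the two bonds next to a site are compatible with that site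
    (∀ (j : ℕ) (ν : DihedralGroup N × DihedralGroup N → Circle),
      DihedralLSM.IsFactorSystem (DihedralLSM.siteOp N a j) ν →
      ¬ ∃ ω ω' : DihedralGroup N × DihedralGroup N → Circle,
        DihedralLSM.IsCocycle ω ∧ DihedralLSM.IsCocycle ω' ∧
        DihedralLSM.Cohomologous ω' (ν * ω) ∧
        DihedralLSM.Cohomologous ω'
          (DihedralLSM.pullback (DihedralLSM.translation N a) ω)) ∧
    -- and no symmetric injective matrix product state exists, for any bond dimension
    (¬ ∃ (D : ℕ) (A : ZMod N → Matrix (Fin D) (Fin D) ℂ),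
      DihedralLSM.IsInjectiveMPS A ∧ DihedralLSM.IsSymmetricMPS N a L A) := by
  have hodd := DihedralLSM.odd_of_isCoprime hN ha
  refine ⟨DihedralLSM.exists_mulEquiv_projective a hN hL,
    DihedralLSM.exists_mulEquiv_linear_iff a hN hL,
    ⟨DihedralLSM.translation_bijective ha, fun j g => DihedralLSM.siteOp_succ g⟩,
    fun j => ?_, fun ω hω => ⟨?_, fun ω' h => DihedralLSM.halfTurnPhase_congr hN h⟩,
    fun ω _ m hm j ν hν => ⟨?_, ?_⟩, fun ⟨m, hm⟩ => DihedralLSM.not_modEq_one hodd m hm, ?_,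
    DihedralLSM.not_exists_symmetric_injective_MPS hN hodd hL⟩
  · have hν := DihedralLSM.isFactorSystem_siteCocycle N a j
    have hphase := DihedralLSM.halfTurnPhase_siteOp hN hodd hν
    exact ⟨_, hν, hν.isCocycle, hphase.trans hodd.pow.neg_one_zpow.symm, hphase,
      DihedralLSM.not_isCoboundary_of_halfTurnPhase hN hphase⟩
  · rcases hω.halfTurnPhase_eq hN with h | h
    · exact ⟨0, Or.inl rfl, by simpa using h⟩
    · exact ⟨1, Or.inr rfl, by simpa using h⟩
  · rw [DihedralLSM.halfTurnPhase_pullback hN hodd, hm]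
    rcases Int.even_or_odd m with h | h
    · rw [h.neg_one_zpow, (h.mul_right _).neg_one_zpow]
    · rw [h.neg_one_zpow, (h.mul hodd.pow).neg_one_zpow]
  -- Both sides fail: the left says that a nonzero invariant equals its own negative, and on the
  -- right `a - 1` is even.
  · refine iff_of_false (fun h => ?_) (DihedralLSM.not_modEq_one hodd m)
    rw [DihedralLSM.halfTurnPhase_mul, DihedralLSM.halfTurnPhase_siteOp hN hodd hν,
      DihedralLSM.halfTurnPhase_pullback hN hodd, DihedralLSM.halfTurnPhase_pullback hN hodd,
      neg_one_mul, self_eq_neg] at h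
    exact DihedralLSM.halfTurnPhase_ne_zero ω h
  · rintro j ν hν ⟨ω, ω', -, -, h1, h2⟩
    have h3 := (DihedralLSM.halfTurnPhase_congr hN h1).symm.trans
      (DihedralLSM.halfTurnPhase_congr hN h2)
    have h4 := DihedralLSM.halfTurnPhase_pullback hN hodd ω 1
    rw [Function.iterate_one] at h4
    rw [DihedralLSM.halfTurnPhase_mul, DihedralLSM.halfTurnPhase_siteOp hN hodd hν, h4,
      neg_one_mul, neg_eq_self] at h3
    exact DihedralLSM.halfTurnPhase_ne_zero ω h3
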